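/- Let $K$ be a field, let $s\ge 1$, let $S=K[t_1,\ldots,t_s]=\bigoplus_{d\ge 0}S_d$ be the polynomial ring with the standard grading, and let $\prec$ be a monomial order on $S$. For a graded ideal $J\subset S$ with $k=\dim(S/J)$ (Krull dimension) and Hilbert function $H_J(d)=\dim_K(S_d/(J\cap S_d))$, the degree of $S/J$ is $$\deg(S/J)=\begin{cases}(k-1)!\,\lim_{d\to\infty}H_J(d)/d^{k-1}&\text{if }k\ge 1,\\ \dim_K(S/J)&\text{if }k=0.\end{cases}$$ Let ${\rm in}_\prec(J)$ be the ideal generated by the leading monomials of the non-zero elements of $J$, and let $\Delta_\prec(J)_d$ be the set of monomials of degree $d$ that are not the leading monomial of any non-zero element of $J$. The footprint function of $J$ is $${\rm fp}_J(d)=\begin{cases}\deg(S/J)-\max\{\deg(S/({\rm in}_\prec(J),t^a))\mid t^a\in\Delta_\prec(J)_d\}&\text{if }\Delta_\prec(J)_d\ne\emptyset,\\ \deg(S/J)&\text{if }\Delta_\prec(J)_d=\emptyset.\end{cases}$$ Let $\mathbb{X}=\{[P_1],\ldots,[P_m]\}$ be a finite subset of the projective space $\mathbb{P}^{s-1}$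 over $K$, with $m=|\mathbb{X}|$, and let $I(\mathbb{X})\subset S$ be its vanishing ideal, generated by the homogeneous polynomials that vanish at all points of $\mathbb{X}$. For $d\ge 1$, choose $g_1,\ldots,g_m\in S_d$ with $g_i(P_i)\ne 0$ for all $i$, and let $\delta_{\mathbb{X}}(d)$ be the minimum distance (the least number of non-zero entries of a non-zero codeword) of the linear code $$C_{\mathbb{X}}(d)=\left\{\left(\frac{f(P_1)}{g_1(P_1)},\ldots,\frac{f(P_m)}{g_m(P_m)}\right)\ \middle|\ f\in S_d\right\}\subset K^m;$$ it does not depend on the choice of the representatives $P_i$ and of the $g_i$. If $t_i$ is a zero-divisor of $S/I(\mathbb{X})$ for $i=1,\ldots,s$ (that is, $t_i\bar a=\bar 0$ for some $\bar a\ne\bar 0$ in $S/I(\mathbb{X})$), then $$\delta_{\mathbb{X}}(d)\ \ge\ {\rm fp}_{I(\mathbb{X})}(d)\ \ge\ 0\qquad\text{for all } d\ge 1.$$ -/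

import Mathlib

namespace ProjectiveCode

/-- `I_d = I ∩ S_d`, as a subspace of the space `S_d` of forms of degree `d`. -/
noncomputable def gradedPiece {K : Type*} [Field K] {s : ℕ}
    (I : Ideal (MvPolynomial (Fin s) K)) (d : ℕ) :
    Submodule K (MvPolynomial.homogeneousSubmodule (Fin s) K d) :=
  (I.restrictScalars K).comap (MvPolynomial.homogeneousSubmodule (Fin s) K d).subtype

/-- The Hilbert function `H_I(d) = dim_K (S_d / I_d)`. -/
noncomputable def hilbertFunction {K : Type*} [Field K] {s : ℕ}
    (I : Ideal (MvPolynomial (Fin s) K)) (d : ℕ) : ℕ :=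
  Module.finrank K (MvPolynomial.homogeneousSubmodule (Fin s) K d ⧸ gradedPiece I d)

/-- The Krull dimension of `S / I` as a natural number (it is never infinite here; the zero ring
gets the value `0`). -/
noncomputable def krullDim {K : Type*} [Field K] {s : ℕ}
    (I : Ideal (MvPolynomial (Fin s) K)) : ℕ :=
  ((ringKrullDim (MvPolynomial (Fin s) K ⧸ I)).unbotD 0).toNat

/-- The degree (multiplicity) of `S / I` for a graded ideal `I`: with `k = dim (S / I)`, it is
`(k - 1)! * lim_d H_I(d) / d ^ (k - 1)` if `k ≥ 1`, and `dim_K (S / I)` if `k = 0`. -/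
noncomputable def degree {K : Type*} [Field K] {s : ℕ}
    (I : Ideal (MvPolynomial (Fin s) K)) : ℝ :=
  if krullDim I = 0 then
    (Module.finrank K (MvPolynomial (Fin s) K ⧸ I) : ℝ)
  else
    ((krullDim I - 1).factorial : ℝ) *
      Filter.limUnder Filter.atTop
        (fun d : ℕ => (hilbertFunction I d : ℝ) / (d : ℝ) ^ (krullDim I - 1))

/-- `f` is a zero-divisor of `S / I`. -/
def IsZeroDivisorMod {K : Type*} [Field K] {s : ℕ}
    (I : Ideal (MvPolynomial (Fin s) K)) (f : MvPolynomial (Fin s) K) : Prop :=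
  ∃ a : MvPolynomial (Fin s) K ⧸ I, a ≠ 0 ∧ Ideal.Quotient.mk I f * a = 0

/-- The initial ideal of `I`, generated by the leading monomials of the non-zero elements
of `I`. -/
noncomputable def initialIdeal {K : Type*} [Field K] {s : ℕ} (m : MonomialOrder (Fin s))
    (I : Ideal (MvPolynomial (Fin s) K)) : Ideal (MvPolynomial (Fin s) K) :=
  Ideal.span {g | ∃ f ∈ I, f ≠ 0 ∧ g = MvPolynomial.monomial (m.degree f) (1 : K)}

/-- The exponents `a` of degree `d` such that `t^a` is a standard monomial of `S / I`, that is, not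
the leading monomial of any non-zero element of `I`. -/
def standardMonomials {K : Type*} [Field K] {s : ℕ} (m : MonomialOrder (Fin s))
    (I : Ideal (MvPolynomial (Fin s) K)) (d : ℕ) : Set (Fin s →₀ ℕ) :=
  {a | a.degree = d ∧ ¬ ∃ f ∈ I, f ≠ 0 ∧ m.degree f = a}

open Classical in
/-- The footprint function `fp_I(d)`. The supremum is over a finite set, so it is a maximum. -/
noncomputable def footprint {K : Type*} [Field K] {s : ℕ} (m : MonomialOrder (Fin s))
    (I : Ideal (MvPolynomial (Fin s) K)) (d : ℕ) : ℝ :=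
  if (standardMonomials m I d).Nonempty then
    degree I -
      sSup ((fun a => degree (initialIdeal m I ⊔ Ideal.span {MvPolynomial.monomial a (1 : K)})) ''
        standardMonomials m I d)
  else degree I

/-- The vanishing ideal `I(X)`, generated by the homogeneous polynomials that vanish at all points
of `X`. -/
noncomputable def vanishingIdeal {K : Type*} [Field K] {s : ℕ}
    (X : Finset (Projectivization K (Fin s → K))) : Ideal (MvPolynomial (Fin s) K) :=
  Ideal.span {f | (∃ d : ℕ, f.IsHomogeneous d) ∧
    ∀ (v : Fin s → K) (hv : v ≠ 0), Projectivization.mk K v hv ∈ X → MvPolynomial.eval v f = 0}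

/-- The evaluation map `f ↦ (f(P_x) / g_x(P_x))_x` on forms of degree `d`, for representatives
`P_x` of the points `x` of `X` and denominators `g_x`. -/
noncomputable def evalMap {K : Type*} [Field K] {s : ℕ}
    {X : Finset (Projectivization K (Fin s → K))} (d : ℕ)
    (P : X → (Fin s → K)) (g : X → MvPolynomial (Fin s) K) :
    MvPolynomial.homogeneousSubmodule (Fin s) K d →ₗ[K] (X → K) where
  toFun f := fun x => MvPolynomial.eval (P x) f.1 / MvPolynomial.eval (P x) (g x)
  map_add' f h := by
    funext x
    simp [add_div]
  map_smul' c f := by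
    funext x
    simp [mul_div_assoc]

open Classical in
/-- The minimum distance of a linear code: the least number of non-zero entries of a non-zero
codeword. -/
noncomputable def minDistance {K : Type*} [Field K] {ι : Type*} [Fintype ι]
    (C : Submodule K (ι → K)) : ℕ :=
  sInf {n | ∃ v ∈ C, v ≠ 0 ∧ hammingNorm v = n}

end ProjectiveCode

/-! Everything reduces to counting monomials. A polynomial lies in I(X) exactly when it restricts to
zero on the line through each point of X, so I(X) is a finite intersection of primes with quotient
K[T]. With interpolation this gives dimension 1 and degree |X|.

For a standard monomial t^a of degree d ≥ 1, the ideal J = in(I) + (t^a) is monomial, so its Hilbert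
function counts the monomials outside it. The count is at most |X|, because standard monomials of
one degree are independent as functions on X. A bounded count is eventually non-increasing, hence
constant. If it never reaches 0, then dim S/J = 1 and deg(S/J) is the eventual count
(`exists_degree_span_monomial_eq`).

The key inequality is `card_zeros_le_ncard_outside`: if f ≠ 0 with leading exponent a vanishes on Z,
then in degrees n ≥ |X| the monomials outside J, evaluated on Z, span K^Z, so there are at least |Z|
of them. The zero-divisor hypothesis makes each t_i, and so each t^a with a ≠ 0, vanish at some
point of X. Thus the count is at least 1 and the case of dimension 0, where the degree is the full
dim S/J, is excluded.

Finally, every codeword comes from a combination f of standard monomials. Its weight is |X| minus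
its number of zeros, which is at least |X| - deg(S/J) with a the leading exponent of f. -/

namespace ProjectiveCode

open MvPolynomial

/-! ### Restriction to lines, and a criterion for dimension 1. -/

section LineEval

variable {K : Type*} [Field K] {s : ℕ}

/-- Restriction of polynomials to the line spanned by `v`: the substitution `t_i ↦ v_i T`. -/
noncomputable def lineEval (v : Fin s → K) : MvPolynomial (Fin s) K →ₐ[K] Polynomial K :=
  aeval fun i => Polynomial.C (v i) * Polynomial.X

theorem lineEval_monomial (v : Fin s → K) (a : Fin s →₀ ℕ) (c : K) :
    lineEval v (monomial a c) = Polynomial.monomial a.degree (eval v (monomial a c)) := by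
  rw [lineEval, aeval_monomial, eval_monomial, Finsupp.prod, Finsupp.prod, Finsupp.degree_apply,
    Polynomial.algebraMap_eq]
  simp only [mul_pow, Finset.prod_mul_distrib, Finset.prod_pow_eq_pow_sum]
  rw [← Polynomial.C_mul_X_pow_eq_monomial, Polynomial.C_mul, map_prod]
  simp only [Polynomial.C_pow, mul_assoc]

theorem lineEval_of_isHomogeneous (v : Fin s → K) {f : MvPolynomial (Fin s) K} {n : ℕ}
    (hf : f.IsHomogeneous n) : lineEval v f = Polynomial.monomial n (eval v f) := by
  conv_lhs => rw [f.as_sum]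
  conv_rhs => rw [f.as_sum]
  rw [map_sum, map_sum, map_sum]
  refine Finset.sum_congr rfl fun a ha => ?_
  rw [lineEval_monomial, hf.degree_eq_sum_deg_support ha]
  rfl

theorem coeff_lineEval (v : Fin s → K) (f : MvPolynomial (Fin s) K) (n : ℕ) :
    (lineEval v f).coeff n = eval v (homogeneousComponent n f) := by
  induction f using MvPolynomial.induction_on' with
  | monomial a c =>
    rw [lineEval_monomial, Polynomial.coeff_monomial,
      homogeneousComponent_of_mem (isHomogeneous_monomial c rfl)]
    simp only [eq_comm (a := n)]
    split_ifs <;> simp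
  | add p q hp hq => simp [hp, hq]

theorem lineEval_surjective {v : Fin s → K} (hv : v ≠ 0) : Function.Surjective (lineEval v) := by
  obtain ⟨i, hi⟩ := Function.ne_iff.1 hv
  intro p
  refine ⟨Polynomial.aeval (C (v i)⁻¹ * X i) p, ?_⟩
  rw [← Polynomial.aeval_algHom_apply]
  have : lineEval v (C (v i)⁻¹ * X i) = Polynomial.X := by
    rw [map_mul, lineEval, aeval_C, aeval_X, Polynomial.algebraMap_eq, ← mul_assoc,
      ← Polynomial.C_mul, inv_mul_cancel₀ hi, Polynomial.C_1, one_mul]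
  rw [this, Polynomial.aeval_X_left_apply]

/-- The image of `Q` in the principal ideal domain K[T] is a non-zero prime, hence maximal. -/
theorem isMaximal_of_ker_lineEval_lt {v : Fin s → K} (hv : v ≠ 0)
    (Q : Ideal (MvPolynomial (Fin s) K)) [Q.IsPrime] (hQ : RingHom.ker (lineEval v) < Q) :
    Q.IsMaximal := by
  have hs : Function.Surjective (lineEval v).toRingHom := lineEval_surjective hv
  have hk : RingHom.ker (lineEval v).toRingHom < Q := hQ
  have hp : (Q.map (lineEval v).toRingHom).IsPrime := Ideal.map_isPrime_of_surjective hs hk.le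
  have hm : (Q.map (lineEval v).toRingHom).IsMaximal := by
    refine IsPrime.to_maximal_ideal ?_
    rw [ne_eq, Ideal.map_eq_bot_iff_le_ker]
    exact hk.not_ge
  have := Ideal.comap_isMaximal_of_surjective _ hs (K := Q.map (lineEval v).toRingHom)
  rwa [Ideal.comap_map_of_surjective' _ hs, sup_eq_left.2 hk.le] at this

/-- S/J maps onto K[T], so the dimension is at least 1. Conversely, a prime that is not minimal over
`J` strictly contains the ideal of a line, so it is maximal. -/
theorem krullDim_eq_one {J : Ideal (MvPolynomial (Fin s) K)} {v : Fin s → K} (hv : v ≠ 0)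
    (hJ : J ≤ RingHom.ker (lineEval v))
    (hQ : ∀ Q : Ideal (MvPolynomial (Fin s) K), Q.IsPrime → J ≤ Q →
      ∃ w : Fin s → K, w ≠ 0 ∧ RingHom.ker (lineEval w) ≤ Q) :
    krullDim J = 1 := by
  have h1 : (1 : WithBot ℕ∞) ≤ ringKrullDim (MvPolynomial (Fin s) K ⧸ J) := by
    rw [← IsPrincipalIdealRing.ringKrullDim_eq_one (Polynomial K) (Polynomial.not_isField K)]
    exact ringKrullDim_le_of_surjective
      (Ideal.Quotient.lift J (lineEval v).toRingHom fun a ha => hJ ha)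
      (Ideal.Quotient.lift_surjective_of_surjective _ _ (lineEval_surjective hv))
  have h2 : Ring.KrullDimLE 1 (MvPolynomial (Fin s) K ⧸ J) := by
    refine Ring.krullDimLE_one_iff.2 fun Q hQp => or_iff_not_imp_left.2 fun hQm => ?_
    rw [minimalPrimes_eq_minimals, Set.notMem_ofPred_iff, not_minimal_iff_exists_lt hQp] at hQm
    obtain ⟨Q', hlt, hQ'⟩ := hQm
    have hs := Ideal.Quotient.mk_surjective (I := J)
    have hle : ∀ R : Ideal (MvPolynomial (Fin s) K ⧸ J), J ≤ R.comap (Ideal.Quotient.mk J) :=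
      fun R a ha => by
        rw [Ideal.mem_comap, Ideal.Quotient.eq_zero_iff_mem.2 ha]
        exact R.zero_mem
    have hQ'' : Q'.IsPrime := hQ'
    obtain ⟨w, hw, hwQ⟩ := hQ (Q'.comap (Ideal.Quotient.mk J)) inferInstance (hle Q')
    have hlt' : Q'.comap (Ideal.Quotient.mk J) < Q.comap (Ideal.Quotient.mk J) :=
      lt_of_le_not_ge (Ideal.comap_mono hlt.le) fun h =>
        hlt.not_ge ((Ideal.comap_le_comap_iff_of_surjective _ hs _ _).1 h)
    have := isMaximal_of_ker_lineEval_lt hw (Q.comap (Ideal.Quotient.mk J)) (hwQ.trans_lt hlt')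
    rw [← Ideal.map_comap_of_surjective _ hs Q]
    refine (Ideal.map_eq_top_or_isMaximal_of_surjective _ hs this).resolve_left ?_
    rw [Ideal.map_comap_of_surjective _ hs Q]
    exact hQp.ne_top
  have h3 : ringKrullDim (MvPolynomial (Fin s) K ⧸ J) = 1 :=
    le_antisymm (by exact_mod_cast Ring.krullDimLE_iff.1 h2) h1
  rw [krullDim, h3]
  rfl

theorem degree_eq_of_eventually {J : Ideal (MvPolynomial (Fin s) K)} (hJ : krullDim J = 1)
    {L n₀ : ℕ} (hL : ∀ n ≥ n₀, hilbertFunction J n = L) : degree J = L := by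
  rw [degree, hJ, if_neg one_ne_zero]
  have : Filter.Tendsto (fun d : ℕ => (hilbertFunction J d : ℝ) / (d : ℝ) ^ (1 - 1))
      Filter.atTop (nhds (L : ℝ)) := by
    refine tendsto_const_nhds.congr' ?_
    filter_upwards [Filter.eventually_ge_atTop n₀] with n hn
    simp [hL n hn]
  rw [this.limUnder_eq]
  simp

end LineEval

/-! ### Hilbert functions of monomial ideals. -/

section MonomialIdeal

variable {K : Type*} [Field K] {s : ℕ}

/-- The exponents of degree `n` of the monomials outside the ideal generated by `t^b`, `b ∈ T`. -/
def outside (T : Set (Fin s →₀ ℕ)) (n : ℕ) : Set (Fin s →₀ ℕ) :=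
  {u | u.degree = n ∧ ∀ t ∈ T, ¬ t ≤ u}

theorem finite_degree_eq (n : ℕ) : {u : Fin s →₀ ℕ | u.degree = n}.Finite :=
  (Finsupp.finite_of_degree_le n).subset fun _ hu => le_of_eq hu

theorem outside_finite (T : Set (Fin s →₀ ℕ)) (n : ℕ) : (outside T n).Finite :=
  (finite_degree_eq n).subset fun _ hu => hu.1

theorem mem_span_monomial_iff {T : Set (Fin s →₀ ℕ)} {f : MvPolynomial (Fin s) K} :
    f ∈ Ideal.span ((fun u => monomial u (1 : K)) '' T) ↔ ∀ u ∈ f.support, ∃ t ∈ T, t ≤ u :=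
  mem_ideal_span_monomial_image

/-- The coefficients at the outside monomials are coordinates on the quotient. -/
theorem hilbertFunction_span_monomial (T : Set (Fin s →₀ ℕ)) (n : ℕ) :
    hilbertFunction (Ideal.span ((fun u => monomial u (1 : K)) '' T)) n = (outside T n).ncard := by
  have := (outside_finite T n).fintype
  let e : homogeneousSubmodule (Fin s) K n →ₗ[K] (outside T n → K) :=
    LinearMap.pi fun u => (lcoeff K u.1).comp (homogeneousSubmodule (Fin s) K n).subtype
  have he : ∀ f u, e f u = coeff u.1 f.1 := fun f u => rfl
  have hker : LinearMap.ker e =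
      gradedPiece (Ideal.span ((fun u => monomial u (1 : K)) '' T)) n := by
    ext f
    rw [LinearMap.mem_ker, gradedPiece, Submodule.mem_comap, Submodule.restrictScalars_mem,
      Submodule.subtype_apply, mem_span_monomial_iff]
    constructor
    · intro h u hu
      by_contra! hc
      have hd : u.degree = n := 
        (((mem_homogeneousSubmodule _ _).1 f.2).degree_eq_sum_deg_support hu).symm
      exact mem_support_iff.1 hu (congrFun h ⟨u, hd, hc⟩)
    · intro h
      funext u
      by_contra hc
      obtain ⟨t, ht, htu⟩ := h u.1 (mem_support_iff.2 hc)
      exact u.2.2 t ht htu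
  have hsurj : Function.Surjective e := by
    intro c
    refine ⟨⟨∑ u : outside T n, monomial u.1 (c u), Submodule.sum_mem _ fun u _ =>
      isHomogeneous_monomial _ u.2.1⟩, ?_⟩
    funext v
    classical
    rw [he]
    simp [coeff_sum, coeff_monomial, Subtype.coe_inj]
  rw [hilbertFunction, ← hker, (LinearMap.quotKerEquivOfSurjective e hsurj).finrank_eq,
    Module.finrank_fintype_fun_eq_card, ← Nat.card_coe_set_eq, Nat.card_eq_fintype_card]

end MonomialIdeal

/-! ### Monomial ideals with bounded Hilbert function. -/

section BoundedMonomialIdeal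

variable {K : Type*} [Field K] {s : ℕ}

theorem exists_eq_of_eventually_antitone {f : ℕ → ℕ} {n₀ : ℕ}
    (hf : ∀ n ≥ n₀, f (n + 1) ≤ f n) : ∃ L n₁, n₀ ≤ n₁ ∧ ∀ n ≥ n₁, f n = L := by
  obtain ⟨n₁, hn₁, hL⟩ : sInf (f '' Set.Ici n₀) ∈ f '' Set.Ici n₀ :=
    Nat.sInf_mem ⟨_, n₀, Set.mem_Ici.2 le_rfl, rfl⟩
  refine ⟨sInf (f '' Set.Ici n₀), n₁, hn₁, fun n hn => ?_⟩
  refine le_antisymm ?_ (Nat.sInf_le ⟨n, le_trans hn₁ hn, rfl⟩)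
  induction n, hn using Nat.le_induction with
  | base => exact hL.le
  | succ n hn ih => exact (hf n (le_trans hn₁ hn)).trans ih

variable {T : Set (Fin s →₀ ℕ)} {M : ℕ}

/-- Otherwise the M + 1 divisors t_i^p t_j^(M-p) of t_i^M t_j^M would all be outside in degree M. -/
theorem exists_le_single_add_single (hM : ∀ n, (outside T n).ncard ≤ M) {i j : Fin s}
    (hij : i ≠ j) : ∃ t ∈ T, t ≤ Finsupp.single i M + Finsupp.single j M := by
  by_contra! hc
  let φ : ℕ → Fin s →₀ ℕ := fun p => Finsupp.single i p + Finsupp.single j (M - p)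
  have hinj : Set.InjOn φ (Finset.range (M + 1) : Set ℕ) := by
    intro p _ q _ hpq
    simpa [φ, hij.symm] using DFunLike.congr_fun hpq i
  have hsub : φ '' (Finset.range (M + 1) : Set ℕ) ⊆ outside T M := by
    rintro _ ⟨p, hp, rfl⟩
    have hp' : p ≤ M := by simpa [Nat.lt_succ_iff] using hp
    refine ⟨by simp only [φ, map_add, Finsupp.degree_single]; omega, fun t ht htu => hc t ht (htu.trans ?_)⟩
    exact add_le_add (Finsupp.single_le_single.2 hp') (Finsupp.single_le_single.2 (Nat.sub_le _ _))
  have h1 := Set.ncard_le_ncard hsub (outside_finite T M)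
  rw [hinj.ncard_image, Set.ncard_coe_finset, Finset.card_range] at h1
  exact absurd (h1.trans (hM M)) (by omega)

theorem eq_of_mem_outside (hM : ∀ n, (outside T n).ncard ≤ M) {n : ℕ} {u : Fin s →₀ ℕ}
    (hu : u ∈ outside T n) {i j : Fin s} (hi : M ≤ u i) (hj : M ≤ u j) : i = j := by
  by_contra hij
  obtain ⟨t, ht, htu⟩ := exists_le_single_add_single hM hij
  refine hu.2 t ht (htu.trans fun l => ?_)
  rw [Finsupp.add_apply, Finsupp.single_apply, Finsupp.single_apply]
  split_ifs with h1 h2 h2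
  · exact absurd (h1.trans h2.symm) hij
  · simpa [← h1] using hi
  · simpa [← h2] using hj
  · simp

theorem exists_lt_apply_of_lt_degree {N : ℕ} {u : Fin s →₀ ℕ} (hu : s * N < u.degree) :
    ∃ i, N < u i := by
  by_contra! hc
  rw [Finsupp.degree_eq_sum] at hu
  have := Finset.sum_le_card_nsmul Finset.univ (fun i => u i) N fun i _ => hc i
  simp at this
  omega

/-- In degree above sM some exponent exceeds M; lower it by one. The result is still outside and
that exponent is still at least M. By `eq_of_mem_outside` only one variable has such an exponent, so
the image determines which variable was divided out, and the map is injective. -/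
theorem ncard_outside_succ_le (hM : ∀ n, (outside T n).ncard ≤ M) {n : ℕ} (hn : s * M ≤ n) :
    (outside T (n + 1)).ncard ≤ (outside T n).ncard := by
  -- `Option` supplies a value off `outside T (n + 1)`, since `Fin s` may be empty.
  have hex : ∀ u : Fin s →₀ ℕ, ∃ i : Option (Fin s), u ∈ outside T (n + 1) →
      ∃ l, i = some l ∧ M < u l := by
    intro u
    by_cases hu : u ∈ outside T (n + 1)
    · obtain ⟨l, hl⟩ := exists_lt_apply_of_lt_degree (N := M) (u := u) (by rw [hu.1]; omega)
      exact ⟨some l, fun _ => ⟨l, rfl, hl⟩⟩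
    · exact ⟨none, fun h => absurd h hu⟩
  choose ι hι using hex
  let φ : (Fin s →₀ ℕ) → (Fin s →₀ ℕ) := fun u => u - (ι u).elim 0 fun l => Finsupp.single l 1
  have hφ : ∀ u ∈ outside T (n + 1), ∃ l, M ≤ φ u l ∧ u = φ u + Finsupp.single l 1 := by
    intro u hu
    obtain ⟨l, hl, hM⟩ := hι u hu
    have : φ u = u - Finsupp.single l 1 := by simp [φ, hl]
    rw [this]
    refine ⟨l, by simp; omega, (tsub_add_cancel_of_le ?_).symm⟩
    rw [Finsupp.single_le_iff]
    omega
  have hmap : ∀ u ∈ outside T (n + 1), φ u ∈ outside T n := by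
    intro u hu
    obtain ⟨l, -, h2⟩ := hφ u hu
    have hdeg := hu.1
    rw [h2, map_add, Finsupp.degree_single] at hdeg
    refine ⟨by omega, fun t ht htu => hu.2 t ht (htu.trans ?_)⟩
    exact tsub_le_self
  refine Set.ncard_le_ncard_of_injOn φ hmap ?_ (outside_finite T n)
  intro u hu w hw huw
  obtain ⟨l, h1, h2⟩ := hφ u hu
  obtain ⟨l', h1', h2'⟩ := hφ w hw
  rw [← huw] at h1' h2'
  rw [h2, h2', eq_of_mem_outside hM (hmap u hu) h1 h1']

/-- If every variable had a power in the ideal, all monomials of large degree would lie in it. -/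
theorem exists_forall_not_le_single {n₀ : ℕ} (h0 : ∀ n ≥ n₀, (outside T n).Nonempty) :
    ∃ i : Fin s, ∀ k, ∀ t ∈ T, ¬ t ≤ Finsupp.single i k := by
  by_contra! hc
  choose k hk using hc
  obtain ⟨u, hu⟩ := h0 (max n₀ (s * Finset.univ.sup k + 1)) (le_max_left _ _)
  obtain ⟨i, hi⟩ := exists_lt_apply_of_lt_degree (N := Finset.univ.sup k) (u := u)
    (by rw [hu.1]; omega)
  obtain ⟨t, ht, hti⟩ := hk i
  refine hu.2 t ht (hti.trans (Finsupp.single_le_iff.2 ?_))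
  exact (Finset.le_sup (Finset.mem_univ i)).trans hi.le

/-- The quotient map modulo `Q` factors through restriction to the i-th coordinate axis. -/
theorem ker_lineEval_single_le {i : Fin s} {Q : Ideal (MvPolynomial (Fin s) K)}
    (hQ : ∀ j, j ≠ i → X j ∈ Q) : RingHom.ker (lineEval (Pi.single i (1 : K))) ≤ Q := by
  have h : (Polynomial.aeval (Ideal.Quotient.mkₐ K Q (X i))).comp (lineEval (Pi.single i (1 : K))) =
      Ideal.Quotient.mkₐ K Q := by
    refine algHom_ext fun j => ?_
    rw [AlgHom.comp_apply, lineEval, aeval_X]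
    by_cases hj : j = i
    · subst hj
      simp
    · simp [hj, Ideal.Quotient.eq_zero_iff_mem.2 (hQ j hj)]
  intro f hf
  rw [← Ideal.Quotient.eq_zero_iff_mem, ← Ideal.Quotient.mkₐ_eq_mk K, ← h, AlgHom.comp_apply,
    (RingHom.mem_ker).1 hf, map_zero]

/-- The zero set is a union of coordinate axes: some axis lies in it, and a prime over the ideal
contains one of any two distinct variables, hence all variables but at most one. -/
theorem krullDim_span_monomial (hM : ∀ n, (outside T n).ncard ≤ M) {n₀ : ℕ}
    (h0 : ∀ n ≥ n₀, (outside T n).Nonempty) :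
    krullDim (Ideal.span ((fun u => monomial u (1 : K)) '' T)) = 1 := by
  obtain ⟨i, hi⟩ := exists_forall_not_le_single h0
  have hne : ∀ i : Fin s, (Pi.single i (1 : K) : Fin s → K) ≠ 0 := fun i => by simp
  refine krullDim_eq_one (hne i) (Ideal.span_le.2 ?_) fun Q hQp hQ => ?_
  · rintro _ ⟨t, ht, rfl⟩
    obtain ⟨j, hji, hj⟩ : ∃ j, j ≠ i ∧ t j ≠ 0 := by
      by_contra! hc
      refine hi (t i) t ht fun j => ?_
      by_cases hj : j = i
      · simp [hj]
      · simp [hc j hj]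
    rw [SetLike.mem_coe, RingHom.mem_ker, lineEval_monomial, eval_monomial, Finsupp.prod,
      Finset.prod_eq_zero (Finsupp.mem_support_iff.2 hj) (by simp [hji, hj])]
    simp
  · have key : ∀ j l : Fin s, j ≠ l → (X j : MvPolynomial (Fin s) K) ∈ Q ∨ X l ∈ Q := by
      intro j l hjl
      have hmem : monomial (Finsupp.single j M + Finsupp.single l M) (1 : K) ∈ Q := by
        refine hQ (mem_span_monomial_iff.2 fun u hu => ?_)
        rw [Finset.mem_singleton.1 (support_monomial_subset hu)]
        exact exists_le_single_add_single hM hjl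
      rw [← one_mul (1 : K), ← monomial_mul, ← X_pow_eq_monomial, ← X_pow_eq_monomial] at hmem
      exact (hQp.mem_or_mem hmem).imp (hQp.mem_of_pow_mem _) (hQp.mem_of_pow_mem _)
    by_cases hall : ∀ j, (X j : MvPolynomial (Fin s) K) ∈ Q
    · exact ⟨_, hne i, ker_lineEval_single_le fun j _ => hall j⟩
    · obtain ⟨l, hl⟩ := not_forall.1 hall
      exact ⟨_, hne l, ker_lineEval_single_le fun j hj => (key j l hj).resolve_right hl⟩

theorem exists_degree_span_monomial_eq (hM : ∀ n, (outside T n).ncard ≤ M) {n₀ : ℕ}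
    (h0 : ∀ n ≥ n₀, (outside T n).Nonempty) :
    ∃ n ≥ n₀, degree (Ideal.span ((fun u => monomial u (1 : K)) '' T)) = (outside T n).ncard := by
  obtain ⟨L, n₁, -, hL⟩ := exists_eq_of_eventually_antitone (f := fun n => (outside T n).ncard)
    (n₀ := s * M) fun n hn => ncard_outside_succ_le hM hn
  refine ⟨max n₀ n₁, le_max_left _ _, ?_⟩
  rw [hL _ (le_max_right _ _)]
  exact degree_eq_of_eventually (krullDim_span_monomial hM h0) (n₀ := n₁) fun n hn => by
    rw [hilbertFunction_span_monomial, hL n hn]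

end BoundedMonomialIdeal

/-! ### Interpolation by forms and reduction modulo leading monomials. -/

section Evaluation

variable {K : Type*} [Field K] {s : ℕ}

/-- Evaluation of polynomials at a family of vectors. -/
noncomputable def evalLin {ι : Type*} (P : ι → Fin s → K) :
    MvPolynomial (Fin s) K →ₗ[K] (ι → K) where
  toFun f := fun x => eval (P x) f
  map_add' f g := by
    funext x
    simp
  map_smul' c f := by
    funext x
    simp

@[simp]
theorem evalLin_apply {ι : Type*} (P : ι → Fin s → K) (f : MvPolynomial (Fin s) K) (x : ι) :
    evalLin P f x = eval (P x) f := rfl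

/-- Lagrange interpolation: multiply linear forms vanishing at each other point but not at `P x`,
and pad the degree with a power of a coordinate that is non-zero at `P x`. -/
theorem exists_isHomogeneous_eval_eq {ι : Type*} [Fintype ι] {P : ι → Fin s → K}
    (h0 : ∀ x, P x ≠ 0) (hP : ∀ x y, x ≠ y → ∃ i j, P x i * P y j ≠ P x j * P y i) {n : ℕ}
    (hn : Fintype.card ι ≤ n) (c : ι → K) :
    ∃ f : MvPolynomial (Fin s) K, f.IsHomogeneous n ∧ evalLin P f = c := by
  classical
  have hsep : ∀ x y, ∃ l : MvPolynomial (Fin s) K, l.IsHomogeneous 1 ∧ (x ≠ y → eval (P x) l ≠ 0 ∧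
      eval (P y) l = 0) := by
    intro x y
    by_cases hxy : x = y
    · exact ⟨0, isHomogeneous_zero _ _ _, fun h => absurd hxy h⟩
    · obtain ⟨i, j, hij⟩ := hP x y hxy
      refine ⟨C (P y j) * X i - C (P y i) * X j,
        (isHomogeneous_C_mul_X _ _).sub (isHomogeneous_C_mul_X _ _), fun _ => ⟨?_, ?_⟩⟩
      · simp only [map_sub, map_mul, eval_C, eval_X]
        rw [sub_ne_zero, mul_comm, mul_comm (P y i)]
        exact hij
      · simp only [map_sub, map_mul, eval_C, eval_X]
        ring
  choose l hl hl' using hsep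
  have hbump : ∀ x, ∃ f : MvPolynomial (Fin s) K, f.IsHomogeneous n ∧
      evalLin P f = Pi.single x 1 := by
    intro x
    obtain ⟨i, hi⟩ := Function.ne_iff.1 (h0 x)
    let g : MvPolynomial (Fin s) K :=
      (∏ y ∈ Finset.univ.erase x, l x y) * X i ^ (n - (Finset.univ.erase x).card)
    have hcard : (Finset.univ.erase x).card ≤ n :=
      (Finset.card_le_univ _).trans hn
    have hg : g.IsHomogeneous n := by
      have := (IsHomogeneous.prod (Finset.univ.erase x) (l x) (fun _ => 1) fun y _ => hl x y).mul
        (isHomogeneous_X_pow (R := K) i (n - (Finset.univ.erase x).card))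
      rwa [Finset.sum_const, smul_eq_mul, mul_one, Nat.add_sub_cancel' hcard] at this
    have hgx : eval (P x) g ≠ 0 := by
      rw [map_mul, map_pow, eval_X, map_prod]
      refine mul_ne_zero (Finset.prod_ne_zero_iff.2 fun y hy => ?_) (pow_ne_zero _ hi)
      exact (hl' x y (Finset.ne_of_mem_erase hy).symm).1
    refine ⟨C (eval (P x) g)⁻¹ * g, hg.C_mul _, ?_⟩
    funext y
    rw [evalLin_apply, map_mul, eval_C]
    by_cases hy : y = x
    · subst hy
      simp [hgx]
    · have hgy : eval (P y) g = 0 := by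
        rw [map_mul, map_prod, Finset.prod_eq_zero (Finset.mem_erase.2 ⟨hy, Finset.mem_univ y⟩)
          (hl' x y (Ne.symm hy)).2, zero_mul]
      rw [Pi.single_eq_of_ne hy, hgy, mul_zero]
  choose f hf hf' using hbump
  refine ⟨∑ x, C (c x) * f x, IsHomogeneous.sum _ _ _ fun x _ => (hf x).C_mul _, ?_⟩
  rw [map_sum]
  simp only [← smul_eq_C_mul, map_smul, hf']
  funext y
  simp [Finset.sum_apply, Pi.single_apply]

/-- Shift `f` by a monomial so that its leading exponent becomes `u`, then take the homogeneous
component containing that term. This component still vanishes at the points, because its values are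
coefficients of zero restrictions to lines. So `f` itself need not be homogeneous. -/
theorem exists_homogeneous_of_degree_le (m : MonomialOrder (Fin s)) {ι : Type*}
    {P : ι → Fin s → K} {f : MvPolynomial (Fin s) K} (hf : f ≠ 0)
    (hv : ∀ x, lineEval (P x) f = 0) {u : Fin s →₀ ℕ} (hu : m.degree f ≤ u) :
    ∃ h ∈ LinearMap.ker (evalLin P), h.IsHomogeneous u.degree ∧ h ≠ 0 ∧ m.degree h = u := by
  have hmon : monomial (u - m.degree f) (1 : K) ≠ 0 := by simp
  let q := monomial (u - m.degree f) (1 : K) * f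
  have hq : q ≠ 0 := mul_ne_zero hmon hf
  have hdq : m.degree q = u := by
    classical
    rw [m.degree_mul hmon hf, m.degree_monomial, if_neg one_ne_zero, tsub_add_cancel_of_le hu]
  have hcu : coeff u (homogeneousComponent u.degree q) ≠ 0 := by
    rw [coeff_homogeneousComponent, if_pos rfl]
    conv_lhs => rw [← hdq]
    exact m.coeff_degree_ne_zero_iff.2 hq
  refine ⟨homogeneousComponent u.degree q, ?_, homogeneousComponent_isHomogeneous _ _,
    fun h => hcu (by rw [h, coeff_zero]), ?_⟩
  · rw [LinearMap.mem_ker]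
    funext x
    rw [evalLin_apply, ← coeff_lineEval, map_mul, hv]
    simp
  · refine m.toSyn.injective (le_antisymm ?_ (m.le_degree (mem_support_iff.2 hcu)))
    rw [← hdq]
    refine m.degree_le_degree_of_support_subset fun w hw => ?_
    rw [mem_support_iff, coeff_homogeneousComponent] at hw
    rw [mem_support_iff]
    exact fun h => hw (by simp [h])

/-- The division algorithm in a single degree, for a mere subspace `V`: a monomial off `N` is
rewritten through smaller ones, by well-founded induction on the order. -/
theorem mem_sup_span_monomial (m : MonomialOrder (Fin s))
    {V : Submodule K (MvPolynomial (Fin s) K)} {N : Set (Fin s →₀ ℕ)} {n : ℕ}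
    (hV : ∀ u, u.degree = n → u ∉ N → ∃ h ∈ V, h.IsHomogeneous n ∧ h ≠ 0 ∧ m.degree h = u)
    {f : MvPolynomial (Fin s) K} (hf : f.IsHomogeneous n) :
    f ∈ V ⊔ Submodule.span K ((fun u => monomial u (1 : K)) '' N) := by
  set W := V ⊔ Submodule.span K ((fun u => monomial u (1 : K)) '' N) with hW
  have hsum : ∀ g : MvPolynomial (Fin s) K, (∀ u ∈ g.support, monomial u (1 : K) ∈ W) → g ∈ W := by
    intro g hg
    rw [g.as_sum]
    refine Submodule.sum_mem _ fun u hu => ?_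
    have := W.smul_mem (coeff u g) (hg u hu)
    rwa [smul_monomial, smul_eq_mul, mul_one] at this
  have key : ∀ w : m.syn, ∀ u : Fin s →₀ ℕ, m.toSyn u = w → u.degree = n →
      monomial u (1 : K) ∈ W := by
    intro w
    induction w using WellFoundedLT.induction with
    | ind w ih =>
      rintro u rfl hu
      by_cases huN : u ∈ N
      · exact Submodule.mem_sup_right (Submodule.subset_span ⟨u, huN, rfl⟩)
      · obtain ⟨h, hhV, hh, h0, rfl⟩ := hV u hu huN
        set c := m.leadingCoeff h with hc
        have hc0 : c ≠ 0 := m.leadingCoeff_ne_zero_iff.2 h0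
        have hr : h - monomial (m.degree h) c ∈ W := by
          refine hsum _ fun u hu' => ?_
          have hne : u ≠ m.degree h := by
            rintro rfl
            rw [mem_support_iff, coeff_sub, coeff_monomial, if_pos rfl] at hu'
            exact hu' (sub_self _)
          have hus : u ∈ h.support := by
            rw [mem_support_iff, coeff_sub, coeff_monomial, if_neg hne.symm, sub_zero] at hu'
            exact mem_support_iff.2 hu'
          exact ih _ (lt_of_le_of_ne (m.le_degree hus) fun e => hne (m.toSyn.injective e)) u rfl
            (hh.degree_eq_sum_deg_support hus).symm
        have h1 : monomial (m.degree h) c ∈ W := by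
          have := W.sub_mem (Submodule.mem_sup_left hhV) hr
          rwa [sub_sub_cancel] at this
        have := W.smul_mem c⁻¹ h1
        rwa [smul_monomial, smul_eq_mul, inv_mul_cancel₀ hc0] at this
  exact hsum f fun u hu => key _ u rfl (hf.degree_eq_sum_deg_support hu).symm

end Evaluation

/-! ### The vanishing ideal: membership, dimension and degree. -/

section VanishingIdeal

variable {K : Type*} [Field K] {s : ℕ} {X : Finset (Projectivization K (Fin s → K))}
  {P : X → (Fin s → K)}

theorem lineEval_smul (a : K) (v : Fin s → K) :
    lineEval (a • v) = (Polynomial.aeval (Polynomial.C a * Polynomial.X)).comp (lineEval v) := by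
  refine algHom_ext fun i => ?_
  simp [lineEval, mul_left_comm, mul_assoc]

theorem mem_vanishingIdeal_iff
    (hP : ∀ x : X, ∃ hx : P x ≠ 0, Projectivization.mk K (P x) hx = x.1)
    {f : MvPolynomial (Fin s) K} : f ∈ vanishingIdeal X ↔ ∀ x, lineEval (P x) f = 0 := by
  constructor
  · intro hf x
    have hle : vanishingIdeal X ≤ RingHom.ker (lineEval (P x)) := by
      refine Ideal.span_le.2 ?_
      rintro g ⟨⟨n, hg⟩, hgv⟩
      obtain ⟨hx, hx'⟩ := hP x
      rw [SetLike.mem_coe, RingHom.mem_ker, lineEval_of_isHomogeneous _ hg,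
        hgv _ hx (hx' ▸ x.2), map_zero]
    exact hle hf
  · intro hf
    rw [← sum_homogeneousComponent f]
    refine Ideal.sum_mem _ fun n _ => Ideal.subset_span
      ⟨⟨n, homogeneousComponent_isHomogeneous _ _⟩, fun v hv hvX => ?_⟩
    obtain ⟨hx, hx'⟩ := hP ⟨_, hvX⟩
    obtain ⟨a, ha⟩ := (Projectivization.mk_eq_mk_iff' K _ _ hv hx).1 hx'.symm
    -- Changing the representative by the scalar `a` amounts to substituting aT for T.
    rw [← coeff_lineEval, ← ha, lineEval_smul, AlgHom.comp_apply, hf, map_zero,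
      Polynomial.coeff_zero]

theorem mem_vanishingIdeal_iff_of_isHomogeneous
    (hP : ∀ x : X, ∃ hx : P x ≠ 0, Projectivization.mk K (P x) hx = x.1)
    {f : MvPolynomial (Fin s) K} {n : ℕ} (hf : f.IsHomogeneous n) :
    f ∈ vanishingIdeal X ↔ evalLin P f = 0 := by
  rw [mem_vanishingIdeal_iff hP, funext_iff]
  refine forall_congr' fun x => ?_
  rw [lineEval_of_isHomogeneous _ hf, Polynomial.monomial_eq_zero_iff]
  rfl

theorem exists_mul_ne_mul
    (hP : ∀ x : X, ∃ hx : P x ≠ 0, Projectivization.mk K (P x) hx = x.1) (x y : X) (hxy : x ≠ y) :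
    ∃ i j, P x i * P y j ≠ P x j * P y i := by
  by_contra! hc
  obtain ⟨hx, hx'⟩ := hP x
  obtain ⟨hy, hy'⟩ := hP y
  obtain ⟨j, hj⟩ := Function.ne_iff.1 hy
  refine hxy (Subtype.ext ?_)
  rw [← hx', ← hy', Projectivization.mk_eq_mk_iff']
  refine ⟨P x j / P y j, funext fun i => ?_⟩
  rw [Pi.smul_apply, smul_eq_mul, div_mul_eq_mul_div, ← hc i j, mul_div_cancel_right₀ _ hj]

theorem krullDim_vanishingIdeal (hne : X.Nonempty) : krullDim (vanishingIdeal X) = 1 := by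
  have hP : ∀ x : X, ∃ hx : x.1.rep ≠ 0, Projectivization.mk K x.1.rep hx = x.1 :=
    fun x => ⟨x.1.rep_nonzero, x.1.mk_rep⟩
  obtain ⟨x, hx⟩ := hne
  refine krullDim_eq_one x.rep_nonzero
    (fun f hf => (mem_vanishingIdeal_iff hP).1 hf ⟨x, hx⟩) fun Q hQp hQ => ?_
  -- A prime containing a finite intersection of ideals contains one of them.
  obtain ⟨y, -, hy⟩ := (hQp.inf_le' (s := (Finset.univ : Finset X))
    (f := fun y => RingHom.ker (lineEval y.1.rep))).1 (le_trans (fun f hf =>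
      (mem_vanishingIdeal_iff hP).2 fun y => by
        have := (Submodule.mem_finsetInf.1 hf) y (Finset.mem_univ y)
        exact this) hQ)
  exact ⟨_, y.1.rep_nonzero, hy⟩

theorem hilbertFunction_vanishingIdeal {n : ℕ} (hn : X.card ≤ n) :
    hilbertFunction (vanishingIdeal X) n = X.card := by
  have hP : ∀ x : X, ∃ hx : x.1.rep ≠ 0, Projectivization.mk K x.1.rep hx = x.1 :=
    fun x => ⟨x.1.rep_nonzero, x.1.mk_rep⟩
  let e := (evalLin fun x : X => x.1.rep).comp (homogeneousSubmodule (Fin s) K n).subtype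
  have hker : LinearMap.ker e = gradedPiece (vanishingIdeal X) n := by
    ext f
    exact (mem_vanishingIdeal_iff_of_isHomogeneous hP f.2).symm
  have hsurj : Function.Surjective e := by
    intro c
    obtain ⟨f, hf, hfc⟩ := exists_isHomogeneous_eval_eq (fun x => (hP x).1)
      (exists_mul_ne_mul hP) (by simpa using hn) c
    exact ⟨⟨f, hf⟩, hfc⟩
  rw [hilbertFunction, ← hker, (LinearMap.quotKerEquivOfSurjective e hsurj).finrank_eq,
    Module.finrank_fintype_fun_eq_card, Fintype.card_coe]

theorem degree_vanishingIdeal (hne : X.Nonempty) : degree (vanishingIdeal X) = X.card :=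
  degree_eq_of_eventually (krullDim_vanishingIdeal hne) (n₀ := X.card) fun _ hn =>
    hilbertFunction_vanishingIdeal hn

/-- If t_i b is in the ideal but b is not, then b is non-zero on some line; as K[T] is a domain, t_i
vanishes on that line. -/
theorem exists_apply_eq_zero_of_isZeroDivisorMod
    (hP : ∀ x : X, ∃ hx : P x ≠ 0, Projectivization.mk K (P x) hx = x.1) {i : Fin s}
    (hi : IsZeroDivisorMod (vanishingIdeal X) (MvPolynomial.X i)) : ∃ x, P x i = 0 := by
  obtain ⟨a, ha, hia⟩ := hi
  obtain ⟨b, rfl⟩ := Ideal.Quotient.mk_surjective a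
  rw [← map_mul, Ideal.Quotient.eq_zero_iff_mem, mem_vanishingIdeal_iff hP] at hia
  rw [ne_eq, Ideal.Quotient.eq_zero_iff_mem, mem_vanishingIdeal_iff hP, not_forall] at ha
  obtain ⟨x, hx⟩ := ha
  have := (mul_eq_zero.1 ((map_mul _ _ _).symm.trans (hia x))).resolve_right hx
  exact ⟨x, by simpa [lineEval] using this⟩

end VanishingIdeal

/-! ### Zeros against outside monomials, and the footprint bound. -/

section Footprint

variable {K : Type*} [Field K] {s : ℕ} {X : Finset (Projectivization K (Fin s → K))}
  {P : X → (Fin s → K)} (m : MonomialOrder (Fin s))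

/-- The exponents of the leading monomials of the non-zero elements of `I`. -/
def leadingExponents (I : Ideal (MvPolynomial (Fin s) K)) : Set (Fin s →₀ ℕ) :=
  {t | ∃ f ∈ I, f ≠ 0 ∧ m.degree f = t}

theorem initialIdeal_sup_span_monomial (I : Ideal (MvPolynomial (Fin s) K)) (a : Fin s →₀ ℕ) :
    initialIdeal m I ⊔ Ideal.span {monomial a (1 : K)} =
      Ideal.span ((fun u => monomial u (1 : K)) '' insert a (leadingExponents m I)) := by
  rw [Set.image_insert_eq, Set.insert_eq, Ideal.span_union, sup_comm]
  congr 1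
  refine congrArg Ideal.span (Set.ext fun g => ?_)
  constructor
  · rintro ⟨f, hf, hf0, rfl⟩
    exact ⟨_, ⟨f, hf, hf0, rfl⟩, rfl⟩
  · rintro ⟨_, ⟨f, hf, hf0, rfl⟩, rfl⟩
    exact ⟨f, hf, hf0, rfl⟩

theorem standardMonomials_finite (I : Ideal (MvPolynomial (Fin s) K)) (n : ℕ) :
    (standardMonomials m I n).Finite :=
  (finite_degree_eq n).subset fun _ hu => hu.1

theorem isHomogeneous_of_mem_span_monomial {N : Set (Fin s →₀ ℕ)} {n : ℕ}
    (hN : ∀ u ∈ N, u.degree = n) {f : MvPolynomial (Fin s) K}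
    (hf : f ∈ Submodule.span K ((fun u => monomial u (1 : K)) '' N)) :
    f.IsHomogeneous n ∧ ∀ u ∈ f.support, u ∈ N := by
  constructor
  · have : Submodule.span K ((fun u => monomial u (1 : K)) '' N) ≤ homogeneousSubmodule _ _ n := by
      refine Submodule.span_le.2 ?_
      rintro _ ⟨u, hu, rfl⟩
      exact isHomogeneous_monomial _ (hN u hu)
    exact this hf
  · intro u hu
    by_contra huN
    have : Submodule.span K ((fun u => monomial u (1 : K)) '' N) ≤ LinearMap.ker (lcoeff K u) := by
      refine Submodule.span_le.2 ?_
      rintro _ ⟨w, hw, rfl⟩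
      classical
      rw [SetLike.mem_coe, LinearMap.mem_ker, lcoeff_apply, coeff_monomial, if_neg]
      rintro rfl
      exact huN hw
    exact mem_support_iff.1 hu (this hf)

/-- A linear relation among their evaluations would be a non-zero form of the ideal with a standard
leading monomial. -/
theorem ncard_standardMonomials_le
    (hP : ∀ x : X, ∃ hx : P x ≠ 0, Projectivization.mk K (P x) hx = x.1) (n : ℕ) :
    (standardMonomials m (vanishingIdeal X) n).ncard ≤ X.card := by
  set N := standardMonomials m (vanishingIdeal X) n with hN
  have := (standardMonomials_finite m (vanishingIdeal X) n).fintype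
  have hli : LinearIndependent K fun u : N => evalLin P (monomial u.1 (1 : K)) := by
    refine Fintype.linearIndependent_iff.2 fun b hb => ?_
    let f : MvPolynomial (Fin s) K := ∑ u : N, b u • monomial u.1 (1 : K)
    have hfe : evalLin P f = 0 := by simpa only [f, map_sum, map_smul] using hb
    have hfs : f ∈ Submodule.span K ((fun u => monomial u (1 : K)) '' N) :=
      Submodule.sum_mem _ fun u _ => Submodule.smul_mem _ _ (Submodule.subset_span ⟨u.1, u.2, rfl⟩)
    obtain ⟨hfh, hsup⟩ := isHomogeneous_of_mem_span_monomial (fun u hu => hu.1) hfs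
    have hf0 : f = 0 := by
      by_contra h0
      exact (hsup _ (m.degree_mem_support h0)).2
        ⟨f, (mem_vanishingIdeal_iff_of_isHomogeneous hP hfh).2 hfe, h0, rfl⟩
    intro u
    classical
    have := congrArg (coeff u.1) hf0
    simpa [f, coeff_sum, coeff_monomial, Subtype.coe_inj] using this
  have := hli.fintype_card_le_finrank
  rwa [Module.finrank_fintype_fun_eq_card, Fintype.card_coe, ← Nat.card_eq_fintype_card,
    Nat.card_coe_set_eq] at this

theorem ncard_outside_le
    (hP : ∀ x : X, ∃ hx : P x ≠ 0, Projectivization.mk K (P x) hx = x.1) (a : Fin s →₀ ℕ) (n : ℕ) :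
    (outside (insert a (leadingExponents m (vanishingIdeal X))) n).ncard ≤ X.card := by
  refine le_trans (Set.ncard_le_ncard ?_ (standardMonomials_finite m _ n))
    (ncard_standardMonomials_le m hP n)
  exact fun u hu => ⟨hu.1, fun h => hu.2 u (Set.mem_insert_of_mem _ h) le_rfl⟩

/-- Monomials of degree n that are not outside are leading monomials of degree-n forms vanishing on
`Z`, obtained from `f` or from the ideal. So modulo forms vanishing on `Z`, all forms of degree n
reduce to outside monomials, while by interpolation they take all values on `Z`. -/
theorem card_zeros_le_ncard_outside
    (hP : ∀ x : X, ∃ hx : P x ≠ 0, Projectivization.mk K (P x) hx = x.1)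
    {f : MvPolynomial (Fin s) K} (hf0 : f ≠ 0) {Z : Finset X}
    (hZ : ∀ x ∈ Z, lineEval (P x) f = 0) {n : ℕ} (hn : X.card ≤ n) :
    Z.card ≤ (outside (insert (m.degree f) (leadingExponents m (vanishingIdeal X))) n).ncard := by
  set N := outside (insert (m.degree f) (leadingExponents m (vanishingIdeal X))) n with hN
  let PZ : Z → Fin s → K := fun z => P z
  have hV : ∀ u, u.degree = n → u ∉ N → ∃ h ∈ LinearMap.ker (evalLin PZ), h.IsHomogeneous n ∧
      h ≠ 0 ∧ m.degree h = u := by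
    rintro u rfl huN
    obtain ⟨t, ht, htu⟩ : ∃ t ∈ insert (m.degree f) (leadingExponents m (vanishingIdeal X)),
        t ≤ u := by
      by_contra! hc
      exact huN ⟨rfl, hc⟩
    obtain rfl | ⟨g, hg, hg0, rfl⟩ := ht
    · exact exists_homogeneous_of_degree_le (P := PZ) m hf0 (fun z => hZ z z.2) htu
    · exact exists_homogeneous_of_degree_le (P := PZ) m hg0
        (fun z => (mem_vanishingIdeal_iff hP).1 hg z) htu
  have htop : Submodule.span K (evalLin PZ '' ((fun u => monomial u (1 : K)) '' N)) = ⊤ := by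
    rw [← Submodule.map_span, eq_top_iff]
    intro c _
    obtain ⟨g, hg, hgc⟩ := exists_isHomogeneous_eval_eq (P := PZ) (fun z => (hP z).1)
      (fun z w hzw => exists_mul_ne_mul hP z w fun h => hzw (Subtype.ext h)) (n := n)
      (le_trans (by simpa using Finset.card_le_univ Z) hn) c
    obtain ⟨g₁, hg₁, g₂, hg₂, rfl⟩ := Submodule.mem_sup.1 (mem_sup_span_monomial m hV hg)
    rw [map_add, LinearMap.mem_ker.1 hg₁, zero_add] at hgc
    exact ⟨g₂, hg₂, hgc⟩
  have hfin := outside_finite (insert (m.degree f) (leadingExponents m (vanishingIdeal X))) n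
  have := ((hfin.image fun u => monomial u (1 : K)).image (evalLin PZ)).fintype
  have hle := finrank_span_le_card (R := K) (evalLin PZ '' ((fun u => monomial u (1 : K)) '' N))
  rw [htop, finrank_top, Module.finrank_fintype_fun_eq_card, Fintype.card_coe,
    ← Set.ncard_eq_toFinset_card'] at hle
  exact hle.trans ((Set.ncard_image_le (hfin.image _)).trans (Set.ncard_image_le hfin))

variable {m}

/-- The zero-divisor hypothesis enters here: t^a vanishes at some point, and the zero count with a
one-point `Z` keeps the outside sets non-empty. -/
theorem degree_initialIdeal_sup_span_monomial
    (hP : ∀ x : X, ∃ hx : P x ≠ 0, Projectivization.mk K (P x) hx = x.1)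
    (hX : ∀ i : Fin s, IsZeroDivisorMod (vanishingIdeal X) (MvPolynomial.X i))
    {a : Fin s →₀ ℕ} (ha : a ≠ 0) :
    ∃ n ≥ X.card, degree (initialIdeal m (vanishingIdeal X) ⊔ Ideal.span {monomial a (1 : K)}) =
      (outside (insert a (leadingExponents m (vanishingIdeal X))) n).ncard := by
  rw [initialIdeal_sup_span_monomial]
  refine exists_degree_span_monomial_eq (ncard_outside_le m hP a) fun n hn => ?_
  obtain ⟨i, hi⟩ := Finsupp.ne_iff.1 ha
  obtain ⟨x, hx⟩ := exists_apply_eq_zero_of_isZeroDivisorMod hP (hX i)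
  have hz : lineEval (P x) (monomial a (1 : K)) = 0 := by
    rw [lineEval_monomial, eval_monomial, Finsupp.prod,
      Finset.prod_eq_zero (Finsupp.mem_support_iff.2 hi) (by rw [hx, zero_pow hi]), mul_zero,
      map_zero]
  have hle := card_zeros_le_ncard_outside m hP (f := monomial a (1 : K)) (by simp) (Z := {x})
    (by simpa using hz) hn
  classical
  rw [m.degree_monomial, if_neg one_ne_zero, Finset.card_singleton] at hle
  exact Set.nonempty_of_ncard_ne_zero (by omega)

theorem degree_initialIdeal_sup_span_monomial_le
    (hP : ∀ x : X, ∃ hx : P x ≠ 0, Projectivization.mk K (P x) hx = x.1)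
    (hX : ∀ i : Fin s, IsZeroDivisorMod (vanishingIdeal X) (MvPolynomial.X i))
    {a : Fin s →₀ ℕ} (ha : a ≠ 0) :
    degree (initialIdeal m (vanishingIdeal X) ⊔ Ideal.span {monomial a (1 : K)}) ≤ X.card := by
  obtain ⟨n, -, h⟩ := degree_initialIdeal_sup_span_monomial (m := m) hP hX ha
  rw [h]
  exact_mod_cast ncard_outside_le m hP a n

theorem card_zeros_le_degree
    (hP : ∀ x : X, ∃ hx : P x ≠ 0, Projectivization.mk K (P x) hx = x.1)
    (hX : ∀ i : Fin s, IsZeroDivisorMod (vanishingIdeal X) (MvPolynomial.X i))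
    {f : MvPolynomial (Fin s) K} (hf0 : f ≠ 0) (ha : m.degree f ≠ 0) {Z : Finset X}
    (hZ : ∀ x ∈ Z, lineEval (P x) f = 0) :
    (Z.card : ℝ) ≤ degree (initialIdeal m (vanishingIdeal X) ⊔
      Ideal.span {monomial (m.degree f) (1 : K)}) := by
  obtain ⟨n, hn, h⟩ := degree_initialIdeal_sup_span_monomial (m := m) hP hX ha
  rw [h]
  exact_mod_cast card_zeros_le_ncard_outside m hP hf0 hZ hn

theorem ne_zero_of_mem_standardMonomials {I : Ideal (MvPolynomial (Fin s) K)} {d : ℕ} (hd : 1 ≤ d)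
    {a : Fin s →₀ ℕ} (ha : a ∈ standardMonomials m I d) : a ≠ 0 := by
  rintro rfl
  have := ha.1
  simp at this
  omega

theorem nonempty_of_isZeroDivisorMod {f : MvPolynomial (Fin s) K}
    (hf : IsZeroDivisorMod (vanishingIdeal X) f) : X.Nonempty := by
  have hP : ∀ x : X, ∃ hx : x.1.rep ≠ 0, Projectivization.mk K x.1.rep hx = x.1 :=
    fun x => ⟨x.1.rep_nonzero, x.1.mk_rep⟩
  obtain ⟨a, ha, -⟩ := hf
  obtain ⟨b, rfl⟩ := Ideal.Quotient.mk_surjective a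
  rw [ne_eq, Ideal.Quotient.eq_zero_iff_mem, mem_vanishingIdeal_iff hP, not_forall] at ha
  obtain ⟨x, -⟩ := ha
  exact ⟨x.1, x.2⟩

theorem footprint_nonneg (hs : 1 ≤ s)
    (hX : ∀ i : Fin s, IsZeroDivisorMod (vanishingIdeal X) (MvPolynomial.X i))
    {d : ℕ} (hd : 1 ≤ d) : 0 ≤ footprint m (vanishingIdeal X) d := by
  have hP : ∀ x : X, ∃ hx : x.1.rep ≠ 0, Projectivization.mk K x.1.rep hx = x.1 :=
    fun x => ⟨x.1.rep_nonzero, x.1.mk_rep⟩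
  rw [footprint, degree_vanishingIdeal (nonempty_of_isZeroDivisorMod (hX ⟨0, hs⟩))]
  split_ifs with h
  · refine sub_nonneg.2 (csSup_le (h.image _) ?_)
    rintro _ ⟨a, ha, rfl⟩
    exact degree_initialIdeal_sup_span_monomial_le hP hX (ne_zero_of_mem_standardMonomials hd ha)
  · exact Nat.cast_nonneg _

theorem footprint_le_hammingNorm [DecidableEq K]
    (hP : ∀ x : X, ∃ hx : P x ≠ 0, Projectivization.mk K (P x) hx = x.1) (hs : 1 ≤ s)
    (hX : ∀ i : Fin s, IsZeroDivisorMod (vanishingIdeal X) (MvPolynomial.X i))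
    {d : ℕ} (hd : 1 ≤ d) {f : MvPolynomial (Fin s) K} (hf : f.IsHomogeneous d)
    (hf0 : evalLin P f ≠ 0) :
    footprint m (vanishingIdeal X) d ≤ (hammingNorm (evalLin P f) : ℝ) := by
  have hV : ∀ u, u.degree = d → u ∉ standardMonomials m (vanishingIdeal X) d →
      ∃ h ∈ LinearMap.ker (evalLin P), h.IsHomogeneous d ∧ h ≠ 0 ∧ m.degree h = u := by
    rintro u rfl hu
    obtain ⟨g, hg, hg0, hgu⟩ : ∃ g ∈ vanishingIdeal X, g ≠ 0 ∧ m.degree g = u := by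
      by_contra hc
      exact hu ⟨rfl, hc⟩
    exact exists_homogeneous_of_degree_le m hg0 ((mem_vanishingIdeal_iff hP).1 hg) hgu.le
  -- `f₂` has the same values as the given form, and its leading monomial is standard.
  obtain ⟨f₁, hf₁, f₂, hf₂, rfl⟩ := Submodule.mem_sup.1 (mem_sup_span_monomial m hV hf)
  rw [map_add, LinearMap.mem_ker.1 hf₁, zero_add] at hf0 ⊢
  obtain ⟨hh, hsup⟩ := isHomogeneous_of_mem_span_monomial (fun u hu => hu.1) hf₂
  have h0 : f₂ ≠ 0 := by
    rintro rfl
    exact hf0 (map_zero _)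
  have ha := hsup _ (m.degree_mem_support h0)
  have hZ : ∀ x ∈ Finset.univ.filter (fun x => evalLin P f₂ x = 0), lineEval (P x) f₂ = 0 := by
    intro x hx
    rw [lineEval_of_isHomogeneous _ hh, ← evalLin_apply P, (Finset.mem_filter.1 hx).2, map_zero]
  have hle := card_zeros_le_degree hP hX h0 (ne_zero_of_mem_standardMonomials hd ha) hZ
  have hcount : ((Finset.univ.filter fun x => evalLin P f₂ x = 0).card : ℝ) +
      hammingNorm (evalLin P f₂) = X.card := by
    rw [← Fintype.card_coe X, ← Finset.card_univ]
    exact_mod_cast Finset.card_filter_add_card_filter_not (s := Finset.univ)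
      fun x => evalLin P f₂ x = 0
  have hsSup := le_csSup (s := (fun a => degree (initialIdeal m (vanishingIdeal X) ⊔
      Ideal.span {monomial a (1 : K)})) '' standardMonomials m (vanishingIdeal X) d)
    ((standardMonomials_finite m _ d).image _).bddAbove ⟨_, ha, rfl⟩
  rw [footprint, if_pos ⟨_, ha⟩, degree_vanishingIdeal (nonempty_of_isZeroDivisorMod (hX ⟨0, hs⟩))]
  linarith

theorem footprint_le_minDistance
    (hP : ∀ x : X, ∃ hx : P x ≠ 0, Projectivization.mk K (P x) hx = x.1) (hs : 1 ≤ s)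
    (hX : ∀ i : Fin s, IsZeroDivisorMod (vanishingIdeal X) (MvPolynomial.X i))
    {d : ℕ} (hd : 1 ≤ d) {g : X → MvPolynomial (Fin s) K} (hg : ∀ x, eval (P x) (g x) ≠ 0) :
    footprint m (vanishingIdeal X) d ≤ (minDistance (LinearMap.range (evalMap d P g)) : ℝ) := by
  classical
  obtain ⟨x, hx⟩ := nonempty_of_isZeroDivisorMod (hX ⟨0, hs⟩)
  obtain ⟨i, hi⟩ := Function.ne_iff.1 (hP ⟨x, hx⟩).1
  -- A power of a coordinate gives a non-zero codeword, so the infimum is attained and is not the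
  -- default value 0 of an empty `sInf`.
  have hne : {n | ∃ v ∈ LinearMap.range (evalMap d P g), v ≠ 0 ∧ hammingNorm v = n}.Nonempty := by
    refine ⟨_, _, ⟨⟨MvPolynomial.X i ^ d, isHomogeneous_X_pow i d⟩, rfl⟩, fun h => ?_, rfl⟩
    have := congrFun h ⟨x, hx⟩
    simp only [evalMap, LinearMap.coe_mk, AddHom.coe_mk, map_pow, eval_X, Pi.zero_apply,
      div_eq_zero_iff, hg, or_false] at this
    exact hi (pow_eq_zero_iff (by omega) |>.1 this)
  obtain ⟨v, ⟨f, hfv⟩, hv0, hvn⟩ := Nat.sInf_mem hne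
  have hmin : minDistance (LinearMap.range (evalMap d P g)) = hammingNorm v := hvn.symm
  have hiff : ∀ x, v x = 0 ↔ evalLin P f.1 x = 0 := fun x => by
    rw [← hfv]
    simp [evalMap, hg]
  have hnorm : hammingNorm v = hammingNorm (evalLin P f.1) :=
    congrArg Finset.card (Finset.filter_congr fun x _ => not_congr (hiff x))
  have hf0 : evalLin P f.1 ≠ 0 := by
    intro h
    apply hv0
    funext x
    rw [Pi.zero_apply, hiff, h, Pi.zero_apply]
  rw [hmin, hnorm]
  exact footprint_le_hammingNorm hP hs hX hd f.2 hf0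

end Footprint
end ProjectiveCode

theorem mainTheorem11 {K : Type*} [Field K] (s : ℕ) (hs : 1 ≤ s) (m : MonomialOrder (Fin s))
    (X : Finset (Projectivization K (Fin s → K)))
    (hX : ∀ i : Fin s, ProjectiveCode.IsZeroDivisorMod (ProjectiveCode.vanishingIdeal X)
      (MvPolynomial.X i))
    (d : ℕ) (hd : 1 ≤ d) :
    (∀ (P : X → (Fin s → K)) (g : X → MvPolynomial (Fin s) K),
      (∀ x : X, ∃ hx : P x ≠ 0, Projectivization.mk K (P x) hx = x.1) →
      (∀ x : X, (g x).IsHomogeneous d ∧ MvPolynomial.eval (P x) (g x) ≠ 0) →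
      ProjectiveCode.footprint m (ProjectiveCode.vanishingIdeal X) d ≤
        (ProjectiveCode.minDistance (LinearMap.range (ProjectiveCode.evalMap d P g)) : ℝ)) ∧
    0 ≤ ProjectiveCode.footprint m (ProjectiveCode.vanishingIdeal X) d :=
  ⟨fun _ _ hP hg => ProjectiveCode.footprint_le_minDistance hP hs hX hd fun x => (hg x).2,
    ProjectiveCode.footprint_nonneg hs hX hd⟩
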